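/- Let $\Lambda$ be a finite set and $n\in\mathbb N$. Let $\Omega_\Lambda=(\mathbb R^n)^\Lambda\times(\mathbb R^n)^\Lambda\cong\mathbb R^{2n|\Lambda|}$ be the phase space of pairs $\omega=(p,q)$, $p=(p_l)_{l\in\Lambda}$, $q=(q_l)_{l\in\Lambda}$, with its Euclidean inner product, and let $C_{\mathcal R}(\Omega_\Lambda)$ be the commutative resolvent algebra, i.e. the C*-subalgebra of $C_{\mathrm b}(\Omega_\Lambda)$ (bounded continuous functions $\Omega_\Lambda\to\mathbb C$ with the supremum norm) generated by the functions $h_x^\lambda(y)=1/(i\lambda-x\cdot y)$, $x\in\Omega_\Lambda$, $\lambda\in\mathbb R\setminus\{0\}$. Let $m_l>0$ and $\nu_l>0$ for $l\in\Lambda$, and let $V_{kl}:\mathbb R^n\to\mathbb R$ ($k,l\in\Lambda$) satisfy $V_{kl}(x)=V_{lk}(-x)$. Let $\mathcal N\subseteq\{\{k,l\}:k,l\in\Lambda,\ k\neq l\}$ and suppose that, for all $\{k,l\}\in\mathcal N$, $V_{kl}\in C_0^1(\mathbb R^n,\mathbb R)$ (that is, $V_{kl}$ is continuously differentiable and vanishes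 at infinity) and $\nabla V_{kl}$ is Lipschitz continuous. Put $$H_{\mathcal N}(p,q)=\sum_{l\in\Lambda}\left(\frac{\|p_l\|^2}{2m_l}+\frac{\nu_l\|q_l\|^2}{2}\right)+\sum_{\{k,l\}\in\mathcal N}V_{kl}(q_k-q_l).$$ Then for every $\omega_0\in\Omega_\Lambda$ Hamilton's equations $(\dot p,\dot q)=(-\nabla_qH_{\mathcal N}(p,q),\nabla_pH_{\mathcal N}(p,q))$ have a unique solution $\mathbb R\to\Omega_\Lambda$ with value $\omega_0$ at time $0$, and, writing $\Phi^t_{H_{\mathcal N}}(\omega_0)$ for the value of this solution at time $t$, $$(\Phi^t_{H_{\mathcal N}})^*\,C_{\mathcal R}(\Omega_\Lambda)=\{f\circ\Phi^t_{H_{\mathcal N}}: f\in C_{\mathcal R}(\Omega_\Lambda)\}=C_{\mathcal R}(\Omega_\Lambda)\qquad\text{for all }t\in\mathbb R.$$ -/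

import Mathlib

namespace ResolventLattice

open Filter Topology
open scoped NNReal BoundedContinuousFunction

noncomputable section

/-! ### The commutative resolvent algebra -/

section Resolvent

variable {X : Type*} [NormedAddCommGroup X] [InnerProductSpace ℝ X]

theorem resolvent_den_norm (r c : ℝ) : |c| ≤ ‖Complex.I * (c : ℂ) - (r : ℂ)‖ := by
  have h := Complex.abs_im_le_norm (Complex.I * (c : ℂ) - (r : ℂ))
  simpa using h

theorem resolvent_den_ne_zero (r : ℝ) {c : ℝ} (hc : c ≠ 0) :
    Complex.I * (c : ℂ) - (r : ℂ) ≠ 0 := by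
  rw [← norm_pos_iff]
  exact (abs_pos.mpr hc).trans_le (resolvent_den_norm r c)

/-- The classical resolvent `h_x^c (y) = 1 / (i c - x ⬝ y)`, for `x ∈ X` and a real `c ≠ 0`,
as a bounded continuous function on `X`. -/
def classicalResolvent (x : X) (c : ℝ) (hc : c ≠ 0) : X →ᵇ ℂ :=
  BoundedContinuousFunction.ofNormedAddCommGroup
    (fun y : X => 1 / (Complex.I * (c : ℂ) - ((inner ℝ x y : ℝ) : ℂ)))
    (by
      refine continuous_const.div ?_ fun y => resolvent_den_ne_zero _ hc
      fun_prop)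
    (1 / |c|)
    (fun y => by
      rw [norm_div, norm_one]
      exact one_div_le_one_div_of_le (abs_pos.mpr hc) (resolvent_den_norm _ c))

variable (X) in
/-- The commutative resolvent algebra `C_R(X)`: the C*-subalgebra of `C_b(X)` generated by the
classical resolvents, i.e. the norm closure of the *-algebra they generate. (The resolvents with
`x = 0` are the nonzero imaginary constants, so it does not matter whether the *-algebra is
generated as a unital one.) -/
def resolventAlgebra : StarSubalgebra ℂ (X →ᵇ ℂ) :=
  (StarAlgebra.adjoin ℂ
    {f : X →ᵇ ℂ | ∃ (x : X) (c : ℝ) (hc : c ≠ 0), f = classicalResolvent x c hc}).topologicalClosure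

variable (X) in
/-- `C_R(X)` as a set of functions `X → ℂ`. -/
def resolventFunctions : Set (X → ℂ) :=
  {g | ∃ f ∈ resolventAlgebra X, ⇑f = g}

end Resolvent

/-! ### Phase space, Hamiltonians and Hamilton's equations -/

/-- `ℝ^{n|Λ|}`, i.e. families `(x_l)_{l ∈ Λ}` of vectors in `ℝⁿ`, given by their components
`x_{l,i}`, with the Euclidean inner product. -/
abbrev Config (Λ : Type*) (n : ℕ) : Type _ := EuclideanSpace ℝ (Λ × Fin n)

/-- The vector `x_l ∈ ℝⁿ`. -/
def particle {Λ : Type*} {n : ℕ} (x : Config Λ n) (l : Λ) : EuclideanSpace ℝ (Fin n) :=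
  WithLp.toLp 2 fun i => x (l, i)

/-- The phase space `Ω_Λ ≅ ℝ^{2n|Λ|}` of pairs `(p, q)`, given by the components `p_{l,i}` (left
summand) and `q_{l,i}` (right summand), with the Euclidean inner product. -/
abbrev Phase (Λ : Type*) (n : ℕ) : Type _ := EuclideanSpace ℝ ((Λ × Fin n) ⊕ (Λ × Fin n))

/-- The point `(p, q)` of phase space. -/
def phasePoint {Λ : Type*} {n : ℕ} (p q : Config Λ n) : Phase Λ n :=
  WithLp.toLp 2 (Sum.elim (fun j => p j) fun j => q j)

/-- The momentum part `p` of `ω = (p, q)`. -/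
def mom {Λ : Type*} {n : ℕ} (ω : Phase Λ n) : Config Λ n :=
  WithLp.toLp 2 fun j => ω (Sum.inl j)

/-- The position part `q` of `ω = (p, q)`. -/
def pos {Λ : Type*} {n : ℕ} (ω : Phase Λ n) : Config Λ n :=
  WithLp.toLp 2 fun j => ω (Sum.inr j)

variable {Λ : Type*} [Fintype Λ] {n : ℕ}

/-- `H⁰_Λ(p, q) = ∑_l (‖p_l‖² / (2 m_l) + ν_l ‖q_l‖² / 2)`. -/
def freeHamiltonian (m ν : Λ → ℝ) (p q : Config Λ n) : ℝ :=
  ∑ l, (‖particle p l‖ ^ 2 / (2 * m l) + ν l * ‖particle q l‖ ^ 2 / 2)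

/-- `V_N(q) = ∑_{{k,l} ∈ N} V_kl(q_k - q_l)`, a sum over unordered pairs, which is meaningful
because `V_kl(x) = V_lk(-x)`. -/
def pairPotential {Λ : Type*} {n : ℕ} (V : Λ → Λ → EuclideanSpace ℝ (Fin n) → ℝ)
    (hV : ∀ k l x, V k l x = V l k (-x)) (N : Finset (Sym2 Λ)) (q : Config Λ n) : ℝ :=
  ∑ e ∈ N, Sym2.lift ⟨fun k l => V k l (particle q k - particle q l),
    fun k l => by simp only [hV k l, neg_sub]⟩ e

/-- `H_N = H⁰_Λ + V_N`. -/
def hamiltonian (m ν : Λ → ℝ) (V : Λ → Λ → EuclideanSpace ℝ (Fin n) → ℝ)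
    (hV : ∀ k l x, V k l x = V l k (-x)) (N : Finset (Sym2 Λ)) (p q : Config Λ n) : ℝ :=
  freeHamiltonian m ν p q + pairPotential V hV N q

/-- The Hamiltonian vector field `X_H(p, q) = (-∇_q H(p, q), ∇_p H(p, q))`. -/
def hamiltonianField (H : Config Λ n → Config Λ n → ℝ) (ω : Phase Λ n) : Phase Λ n :=
  phasePoint (-gradient (fun q => H (mom ω) q) (pos ω)) (gradient (fun p => H p (pos ω)) (mom ω))

/-- `γ : ℝ → Ω_Λ` solves Hamilton's equations for all times, with `γ 0 = ω₀`. -/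
def IsSolution (H : Config Λ n → Config Λ n → ℝ) (ω₀ : Phase Λ n) (γ : ℝ → Phase Λ n) : Prop :=
  γ 0 = ω₀ ∧ ∀ t : ℝ, HasDerivAt γ (hamiltonianField H (γ t)) t

/-- `Φ` is the Hamiltonian flow of `H`: `t ↦ Φ t ω₀` solves Hamilton's equations with initial
value `ω₀`, for every `ω₀`. -/
def IsHamiltonianFlow (H : Config Λ n → Config Λ n → ℝ) (Φ : ℝ → Phase Λ n → Phase Λ n) : Prop :=
  ∀ ω₀ : Phase Λ n, IsSolution H ω₀ fun t => Φ t ω₀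

end

end ResolventLattice

/-! Hamilton's equations read `x' = A x + B x`, with `A` linear (the oscillators) and `B` a finite
sum of maps `J ∘ G ∘ Q`, where `J`, `Q` are linear and `G` is the gradient of a pair potential. A
function that vanishes at infinity and has Lipschitz gradient has a gradient vanishing at infinity,
so `B` is bounded and Lipschitz; this gives global existence and uniqueness.

In the interaction picture, `Ψ_t = e^{-tA} Φ_t` solves `Ψ_t' = F_t(Ψ_t)` with `F_s = e^{-sA} ∘ B ∘
e^{sA}`. It suffices that the displacement `D = Ψ_T - id` has components in the resolvent algebra:
then `Φ_T = e^{TA} ∘ (id + D)`, and pullback by a linear map plus such a `D` preserves the algebra,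
since a perturbed resolvent is an unperturbed one times an inverse that stays in the C*-algebra
(`ResolventVector.comp_mem_resolventFunctions`).

`D` is a uniform limit of Euler schemes whose increments are time integrals of `F_s` at a frozen
point (`ResolventVector.displacement`). Each `F_s` has components in the algebra, but `s ↦ F_s` need
not be continuous in the supremum norm, so its integrals need an argument of their own. By
analyticity of `s ↦ Q e^{sA} u`, a direction `u` is annihilated either for all `s` or for almost
none. Off the common kernel the integral therefore vanishes at infinity (`ResolventVector.average`),
and by Stone–Weierstrass such functions lie in the algebra.

Negative times follow by time reversal, and equality of the algebras by the group property. -/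

namespace ResolventLattice

open Filter Topology
open scoped NNReal BoundedContinuousFunction

noncomputable section

/-! ### Stability properties of the resolvent algebra -/

section Algebra

variable {X Y Z : Type*} [NormedAddCommGroup X] [InnerProductSpace ℝ X]
  [NormedAddCommGroup Y] [InnerProductSpace ℝ Y] [NormedAddCommGroup Z] [InnerProductSpace ℝ Z]

theorem classicalResolvent_apply (x : X) (c : ℝ) (hc : c ≠ 0) (y : X) :
    classicalResolvent x c hc y = 1 / (Complex.I * (c : ℂ) - ((inner ℝ x y : ℝ) : ℂ)) := rfl

theorem isClosed_resolventAlgebra : IsClosed (resolventAlgebra X : Set (X →ᵇ ℂ)) :=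
  StarSubalgebra.isClosed_topologicalClosure _

theorem classicalResolvent_mem (x : X) (c : ℝ) (hc : c ≠ 0) :
    classicalResolvent x c hc ∈ resolventAlgebra X :=
  StarSubalgebra.le_topologicalClosure _
    (StarAlgebra.subset_adjoin ℂ _ ⟨x, c, hc, rfl⟩)

theorem continuous_of_mem_resolventFunctions {f : X → ℂ} (hf : f ∈ resolventFunctions X) :
    Continuous f := by
  obtain ⟨g, -, rfl⟩ := hf
  exact g.continuous

theorem add_mem_resolventFunctions {f g : X → ℂ} (hf : f ∈ resolventFunctions X)
    (hg : g ∈ resolventFunctions X) : (fun x => f x + g x) ∈ resolventFunctions X := by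
  obtain ⟨f, hf, rfl⟩ := hf
  obtain ⟨g, hg, rfl⟩ := hg
  exact ⟨f + g, add_mem hf hg, rfl⟩

theorem zero_mem_resolventFunctions : (fun _ : X => (0 : ℂ)) ∈ resolventFunctions X :=
  ⟨0, zero_mem _, rfl⟩

/-- The functions in the resolvent algebra are closed under uniform limits. -/
theorem mem_resolventFunctions_of_uniform_limit {f : X → ℂ}
    (h : ∀ ε > 0, ∃ g ∈ resolventFunctions X, ∀ x, ‖f x - g x‖ ≤ ε) :
    f ∈ resolventFunctions X := by
  have hcont : Continuous f := by
    have hu : ∀ u ∈ uniformity ℂ, ∃ F, Continuous F ∧ ∀ y, (f y, F y) ∈ u := by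
      intro u hu
      obtain ⟨ε, hε, hεu⟩ := Metric.mem_uniformity_dist.1 hu
      obtain ⟨g, hg, hfg⟩ := h (ε / 2) (half_pos hε)
      refine ⟨g, continuous_of_mem_resolventFunctions hg, fun y => hεu ?_⟩
      rw [dist_eq_norm]
      exact (hfg y).trans_lt (half_lt_self hε)
    exact continuous_of_uniform_approx_of_continuous hu
  obtain ⟨g, ⟨g', hg', rfl⟩, hg⟩ := h 1 one_pos
  let F : X →ᵇ ℂ := BoundedContinuousFunction.ofNormedAddCommGroup f hcont (1 + ‖g'‖) fun x => by
    have h1 := hg x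
    have h2 := g'.norm_coe_le_norm x
    have h3 := norm_add_le (f x - g' x) (g' x)
    rw [sub_add_cancel] at h3
    linarith
  refine ⟨F, ?_, rfl⟩
  rw [← SetLike.mem_coe, ← isClosed_resolventAlgebra.closure_eq, Metric.mem_closure_iff]
  intro ε hε
  obtain ⟨g, ⟨g', hg', rfl⟩, hg⟩ := h (ε / 2) (half_pos hε)
  refine ⟨g', hg', lt_of_le_of_lt ?_ (half_lt_self hε)⟩
  rw [BoundedContinuousFunction.dist_le (half_pos hε).le]
  intro x
  rw [dist_eq_norm]
  exact hg x

/-- To verify that pulling back by a continuous map sends the resolvent algebra to the resolvent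
algebra it suffices to consider resolvents. -/
theorem comp_mem_resolventFunctions_of_resolvents (φ : C(X, Z))
    (h : ∀ z c hc, (classicalResolvent z c hc).compContinuous φ ∈ resolventAlgebra X)
    {f : Z → ℂ} (hf : f ∈ resolventFunctions Z) : f ∘ φ ∈ resolventFunctions X := by
  obtain ⟨f, hf, rfl⟩ := hf
  refine ⟨f.compContinuous φ, ?_, rfl⟩
  have hcont : Continuous fun f : Z →ᵇ ℂ => f.compContinuous φ :=
    BoundedContinuousFunction.continuous_compContinuous φ
  have hclosed := isClosed_resolventAlgebra.preimage hcont
  refine closure_minimal ?_ hclosed hf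
  intro g hg
  refine StarAlgebra.adjoin_induction
    (p := fun g _ => g.compContinuous φ ∈ resolventAlgebra X) ?_ ?_ ?_ ?_ ?_ hg
  · rintro _ ⟨z, c, hc, rfl⟩
    exact h z c hc
  · intro r
    exact algebraMap_mem (resolventAlgebra X) r
  · intro x y _ _ hx hy
    exact add_mem hx hy
  · intro x y _ _ hx hy
    exact mul_mem hx hy
  · intro x _ hx
    exact star_mem hx

/-- Vector-valued functions all of whose components belong to the resolvent algebra. -/
def ResolventVector (D : X → Y) : Prop :=
  ∀ y : Y, (fun x => ((inner ℝ y (D x) : ℝ) : ℂ)) ∈ resolventFunctions X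

theorem ResolventVector.zero : ResolventVector (fun _ : X => (0 : Y)) := fun y => by
  simpa using zero_mem_resolventFunctions

theorem ResolventVector.add {D E : X → Y} (hD : ResolventVector D) (hE : ResolventVector E) :
    ResolventVector fun x => D x + E x := fun y => by
  simpa [inner_add_right] using add_mem_resolventFunctions (hD y) (hE y)

theorem ResolventVector.sum {ι : Type*} (s : Finset ι) {D : ι → X → Y}
    (hD : ∀ i ∈ s, ResolventVector (D i)) : ResolventVector fun x => ∑ i ∈ s, D i x := by
  classical
  induction s using Finset.induction_on with
  | empty => simpa using ResolventVector.zero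
  | insert i s hi ih =>
    simp only [Finset.sum_insert hi]
    exact (hD i (Finset.mem_insert_self i s)).add
      (ih fun j hj => hD j (Finset.mem_insert_of_mem hj))

theorem ResolventVector.of_uniform_limit {D : X → Y}
    (h : ∀ ε > 0, ∃ E : X → Y, ResolventVector E ∧ ∀ x, ‖D x - E x‖ ≤ ε) :
    ResolventVector D := fun y => by
  refine mem_resolventFunctions_of_uniform_limit fun ε hε => ?_
  obtain ⟨E, hE, hDE⟩ := h (ε / (‖y‖ + 1)) (by positivity)
  refine ⟨_, hE y, fun x => ?_⟩
  rw [← Complex.ofReal_sub, ← inner_sub_right, Complex.norm_real]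
  calc ‖inner ℝ y (D x - E x)‖ ≤ ‖y‖ * ‖D x - E x‖ := norm_inner_le_norm _ _
    _ ≤ (‖y‖ + 1) * (ε / (‖y‖ + 1)) := by
      gcongr
      · linarith
      · exact hDE x
    _ = ε := by field_simp

theorem ResolventVector.continuous [FiniteDimensional ℝ Y] {D : X → Y}
    (hD : ResolventVector D) : Continuous D := by
  let b := stdOrthonormalBasis ℝ Y
  have h : D = fun x => ∑ i, (inner ℝ (b i) (D x)) • b i := by
    funext x
    exact (b.sum_repr' (D x)).symm
  rw [h]
  refine continuous_finsetSum _ fun i _ => Continuous.smul ?_ continuous_const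
  have := Complex.continuous_re.comp (continuous_of_mem_resolventFunctions (hD (b i)))
  simpa [Function.comp_def] using this

/-- Pullback by a linear map plus a perturbation with components in the resolvent algebra preserves
the resolvent algebra. -/
theorem ResolventVector.comp_mem_resolventFunctions [FiniteDimensional ℝ Z] [CompleteSpace X]
    {D : X → Z} (hD : ResolventVector D) (L : X →L[ℝ] Z) {f : Z → ℂ}
    (hf : f ∈ resolventFunctions Z) : (fun x => f (L x + D x)) ∈ resolventFunctions X := by
  have hφ : Continuous fun x => L x + D x := L.continuous.add hD.continuous
  refine comp_mem_resolventFunctions_of_resolvents ⟨_, hφ⟩ (fun z c hc => ?_) hf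
  obtain ⟨g, hg, hgD⟩ := hD z
  set r := (classicalResolvent z c hc).compContinuous ⟨_, hφ⟩ with hr
  set h := classicalResolvent (L.adjoint z) c hc with hh
  have hhm : h ∈ resolventAlgebra X := classicalResolvent_mem _ _ _
  have hgx : ∀ x, g x = ((inner ℝ z (D x) : ℝ) : ℂ) := fun x => congrFun hgD x
  have hrx : ∀ x, r x = 1 / (Complex.I * (c : ℂ) - ((inner ℝ z (L x) : ℝ) : ℂ) - g x) := by
    intro x
    rw [hgx, hr, BoundedContinuousFunction.compContinuous_apply, classicalResolvent_apply]
    simp only [ContinuousMap.coe_mk, inner_add_right, Complex.ofReal_add]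
    ring
  have hhx : ∀ x, h x = 1 / (Complex.I * (c : ℂ) - ((inner ℝ z (L x) : ℝ) : ℂ)) := by
    intro x
    rw [hh, classicalResolvent_apply, ContinuousLinearMap.adjoint_inner_left]
  have h1 : ∀ x, Complex.I * (c : ℂ) - ((inner ℝ z (L x) : ℝ) : ℂ) ≠ 0 := fun x =>
    resolvent_den_ne_zero _ hc
  have h2 : ∀ x, Complex.I * (c : ℂ) - ((inner ℝ z (L x) : ℝ) : ℂ) - g x ≠ 0 := fun x => by
    rw [hgx, sub_sub, ← Complex.ofReal_add]
    exact resolvent_den_ne_zero _ hc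
  -- `g * h` need not have norm below 1, so no Neumann series is used. As `g` is real-valued, the
  -- shifted denominator keeps imaginary part `c`, which makes `1 + g * r` an explicit inverse in
  -- the bounded functions; C*-subalgebras are inverse closed.
  have hab : (1 - g * h) * (1 + g * r) = 1 := by
    ext x
    have := h1 x
    have := h2 x
    simp only [BoundedContinuousFunction.coe_mul, BoundedContinuousFunction.coe_sub,
      BoundedContinuousFunction.coe_add, BoundedContinuousFunction.coe_one, Pi.mul_apply,
      Pi.sub_apply, Pi.add_apply, Pi.one_apply, hrx, hhx]
    field_simp
    ring
  have hrb : r = h * (1 + g * r) := by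
    ext x
    have := h1 x
    have := h2 x
    simp only [BoundedContinuousFunction.coe_mul,
      BoundedContinuousFunction.coe_add, BoundedContinuousFunction.coe_one, Pi.mul_apply,
      Pi.add_apply, Pi.one_apply, hrx, hhx]
    field_simp
    ring
  let a : resolventAlgebra X := ⟨1 - g * h, sub_mem (one_mem _) (mul_mem hg hhm)⟩
  have ha : IsUnit (a : X →ᵇ ℂ) := IsUnit.of_mul_eq_one _ hab
  have hcl : IsClosed (resolventAlgebra X : Set (X →ᵇ ℂ)) := isClosed_resolventAlgebra
  have ha' : IsUnit a := (StarSubalgebra.coe_isUnit (S := resolventAlgebra X)).1 ha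
  obtain ⟨b, hb⟩ := ha'.exists_right_inv
  have hb' : (1 - g * h) * (b : X →ᵇ ℂ) = 1 := congrArg Subtype.val hb
  have : (b : X →ᵇ ℂ) = 1 + g * r := by
    calc (b : X →ᵇ ℂ) = ((1 - g * h) * (1 + g * r)) * b := by rw [hab, one_mul]
      _ = ((1 - g * h) * b) * (1 + g * r) := by ring
      _ = 1 + g * r := by rw [hb', one_mul]
  rw [hrb, ← this]
  exact mul_mem hhm b.2

theorem ResolventVector.comp [FiniteDimensional ℝ Z] [CompleteSpace X]
    {D : X → Z} (hD : ResolventVector D) (L : X →L[ℝ] Z) {K : Z → Y} (hK : ResolventVector K) :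
    ResolventVector fun x => K (L x + D x) := fun y =>
  hD.comp_mem_resolventFunctions L (hK y)

theorem comp_linear_mem_resolventFunctions [FiniteDimensional ℝ Z] [CompleteSpace X]
    (L : X →L[ℝ] Z) {f : Z → ℂ} (hf : f ∈ resolventFunctions Z) :
    (fun x => f (L x)) ∈ resolventFunctions X := by
  simpa using (ResolventVector.zero (X := X) (Y := Z)).comp_mem_resolventFunctions L hf

/-! ### Functions vanishing at infinity -/

/-- The product of the resolvents along an orthonormal basis. -/
def basisResolvent {ι : Type*} [Fintype ι] (b : OrthonormalBasis ι ℝ X) : X →ᵇ ℂ :=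
  ∏ i, classicalResolvent (b i) 1 one_ne_zero

theorem basisResolvent_apply {ι : Type*} [Fintype ι] (b : OrthonormalBasis ι ℝ X) (y : X) :
    basisResolvent b y = ∏ i, classicalResolvent (b i) 1 one_ne_zero y := by
  simp [basisResolvent]

theorem norm_classicalResolvent_le_one (x y : X) :
    ‖classicalResolvent x 1 one_ne_zero y‖ ≤ 1 := by
  rw [classicalResolvent_apply, norm_div, norm_one]
  have := resolvent_den_norm (inner ℝ x y) 1
  rw [abs_one] at this
  exact (div_le_one (by linarith)).2 this

theorem norm_classicalResolvent_mul_le (x y : X) :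
    ‖classicalResolvent x 1 one_ne_zero y‖ * |inner ℝ x y| ≤ 1 := by
  rw [classicalResolvent_apply, norm_div, norm_one]
  have h1 := resolvent_den_norm (inner ℝ x y) 1
  rw [abs_one] at h1
  have h2 : |inner ℝ x y| ≤ ‖Complex.I * ((1 : ℝ) : ℂ) - ((inner ℝ x y : ℝ) : ℂ)‖ := by
    simpa using Complex.abs_re_le_norm (Complex.I * ((1 : ℝ) : ℂ) - ((inner ℝ x y : ℝ) : ℂ))
  rw [one_div, inv_mul_le_iff₀ (by linarith), mul_one]
  exact h2

/-- The `i`-th factor absorbs the growth of the `i`-th coordinate and the other factors are at most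
1, so each coordinate contributes at most 1. -/
theorem norm_basisResolvent_mul_le {ι : Type*} [Fintype ι] (b : OrthonormalBasis ι ℝ X) (y : X) :
    ‖basisResolvent b y‖ * ‖y‖ ≤ Fintype.card ι := by
  classical
  have hy : ‖y‖ ≤ ∑ i, |inner ℝ (b i) y| := by
    conv_lhs => rw [← b.sum_repr' y]
    refine (norm_sum_le _ _).trans (Finset.sum_le_sum fun i _ => ?_)
    rw [norm_smul, b.norm_eq_one, mul_one, Real.norm_eq_abs]
  calc ‖basisResolvent b y‖ * ‖y‖
      ≤ ‖basisResolvent b y‖ * ∑ i, |inner ℝ (b i) y| := by gcongr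
    _ = ∑ i, ‖basisResolvent b y‖ * |inner ℝ (b i) y| := Finset.mul_sum _ _ _
    _ ≤ ∑ _i : ι, (1 : ℝ) := by
      refine Finset.sum_le_sum fun i _ => ?_
      refine le_trans ?_ (norm_classicalResolvent_mul_le (b i) y)
      gcongr
      rw [basisResolvent_apply, ← Finset.mul_prod_erase _ _ (Finset.mem_univ i), norm_mul,
        norm_prod]
      exact mul_le_of_le_one_right (norm_nonneg _)
        (Finset.prod_le_one (fun _ _ => norm_nonneg _)
          fun j _ => norm_classicalResolvent_le_one (b j) y)
    _ = Fintype.card ι := by simp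

theorem tendsto_basisResolvent {ι : Type*} [Fintype ι] (b : OrthonormalBasis ι ℝ X) :
    Tendsto (basisResolvent b) (cocompact X) (𝓝 0) := by
  have : FiniteDimensional ℝ X := b.toBasis.finiteDimensional_of_finite
  have : ProperSpace X := FiniteDimensional.proper_real X
  refine squeeze_zero_norm' (a := fun y : X => (Fintype.card ι : ℝ) / ‖y‖) ?_
    ((tendsto_norm_cocompact_atTop (E := X)).const_div_atTop _)
  filter_upwards [(tendsto_norm_cocompact_atTop (E := X)).eventually_gt_atTop 0] with y hy
  rw [le_div_iff₀ hy]
  exact norm_basisResolvent_mul_le b y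

/-- Restriction of continuous functions on the one-point compactification. -/
def restrictOnePoint : C(OnePoint X, ℂ) →⋆ₐ[ℂ] (X →ᵇ ℂ) where
  toFun F := (BoundedContinuousFunction.mkOfCompact F).compContinuous
    ⟨((↑) : X → OnePoint X), OnePoint.continuous_coe⟩
  map_one' := rfl
  map_mul' _ _ := rfl
  map_zero' := rfl
  map_add' _ _ := rfl
  commutes' _ := rfl
  map_star' _ := rfl

omit [InnerProductSpace ℝ X] in
theorem continuous_restrictOnePoint : Continuous (restrictOnePoint (X := X)) :=
  (BoundedContinuousFunction.continuous_compContinuous _).comp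
      (ContinuousMap.isometryEquivBoundedOfCompact (OnePoint X) ℂ).isometry.continuous

variable (X) in
/-- The continuous functions on the one-point compactification whose restrictions belong to the
resolvent algebra. -/
def onePointResolventAlgebra : StarSubalgebra ℂ C(OnePoint X, ℂ) :=
  (resolventAlgebra X).comap restrictOnePoint

theorem isClosed_onePointResolventAlgebra :
    IsClosed (onePointResolventAlgebra X : Set C(OnePoint X, ℂ)) :=
  isClosed_resolventAlgebra.preimage continuous_restrictOnePoint

theorem continuousMapMk_mem_onePointResolventAlgebra (f : X →ᵇ ℂ)
    (hf : f ∈ resolventAlgebra X) (h0 : Tendsto f (coclosedCompact X) (𝓝 0)) :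
    OnePoint.continuousMapMk (f : C(X, ℂ)) 0 h0 ∈ onePointResolventAlgebra X := by
  have : restrictOnePoint (OnePoint.continuousMapMk (f : C(X, ℂ)) 0 h0) = f := rfl
  change restrictOnePoint _ ∈ resolventAlgebra X
  rwa [this]

/-- The nowhere vanishing `g` separates every finite point from infinity. Finite points `x ≠ y` with
`g x = g y` are separated by `g` times the resolvent in direction `x - y`. -/
theorem separatesPoints_onePointResolventAlgebra [FiniteDimensional ℝ X] :
    (onePointResolventAlgebra X).SeparatesPoints := by
  have : ProperSpace X := FiniteDimensional.proper_real X
  let b := stdOrthonormalBasis ℝ X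
  set g := basisResolvent b
  have hg : g ∈ resolventAlgebra X := prod_mem fun i _ => classicalResolvent_mem _ _ _
  have hg0 : Tendsto g (coclosedCompact X) (𝓝 0) := by
    rw [coclosedCompact_eq_cocompact]
    exact tendsto_basisResolvent b
  have hne : ∀ y, g y ≠ 0 := fun y => by
    rw [basisResolvent_apply]
    refine Finset.prod_ne_zero_iff.2 fun i _ => ?_
    rw [classicalResolvent_apply]
    exact one_div_ne_zero (resolvent_den_ne_zero _ one_ne_zero)
  let G := OnePoint.continuousMapMk (g : C(X, ℂ)) 0 hg0
  have hG : G ∈ onePointResolventAlgebra X :=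
    continuousMapMk_mem_onePointResolventAlgebra g hg hg0
  have hsep : ∀ x y : X, x ≠ y → ∃ F ∈ onePointResolventAlgebra X,
      F (x : OnePoint X) ≠ F (y : OnePoint X) := by
    intro x y hxy
    by_cases hxy' : g x = g y
    · set h := classicalResolvent (x - y) 1 one_ne_zero
      have hgh : Tendsto (g * h) (coclosedCompact X) (𝓝 0) := by
        refine squeeze_zero_norm (a := fun z => ‖g z‖) (fun z => ?_) (by simpa using hg0.norm)
        rw [BoundedContinuousFunction.coe_mul, Pi.mul_apply, norm_mul]
        exact mul_le_of_le_one_right (norm_nonneg _) (norm_classicalResolvent_le_one _ _)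
      refine ⟨_, continuousMapMk_mem_onePointResolventAlgebra (g * h)
        (mul_mem hg (classicalResolvent_mem _ _ _)) hgh, ?_⟩
      change g x * h x ≠ g y * h y
      rw [← hxy']
      intro hh
      have hh := mul_left_cancel₀ (hne x) hh
      simp only [h, classicalResolvent_apply, one_div] at hh
      have hh := inv_injective hh
      have hh : inner ℝ (x - y) x = inner ℝ (x - y) y := by simpa using hh
      rw [← sub_eq_zero, ← inner_sub_right, inner_self_eq_zero, sub_eq_zero] at hh
      exact hxy hh
    · exact ⟨G, hG, hxy'⟩
  intro x y hxy
  induction x using OnePoint.rec with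
  | infty =>
    induction y using OnePoint.rec with
    | infty => exact absurd rfl hxy
    | coe y => exact ⟨G, ⟨G, hG, rfl⟩, (hne y).symm⟩
  | coe x =>
    induction y using OnePoint.rec with
    | infty => exact ⟨G, ⟨G, hG, rfl⟩, hne x⟩
    | coe y =>
      obtain ⟨F, hF, hFxy⟩ := hsep x y fun h => hxy (congrArg _ h)
      exact ⟨F, ⟨F, hF, rfl⟩, hFxy⟩

/-- Continuous functions vanishing at infinity on a finite-dimensional space belong to the
resolvent algebra. -/
theorem mem_resolventFunctions_of_tendsto_zero [FiniteDimensional ℝ X] {f : X → ℂ}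
    (hf : Continuous f) (h0 : Tendsto f (cocompact X) (𝓝 0)) : f ∈ resolventFunctions X := by
  have : ProperSpace X := FiniteDimensional.proper_real X
  rw [← coclosedCompact_eq_cocompact] at h0
  -- Stone–Weierstrass on the compact space `OnePoint X`.
  have htop := ContinuousMap.starSubalgebra_topologicalClosure_eq_top_of_separatesPoints
    (onePointResolventAlgebra X) separatesPoints_onePointResolventAlgebra
  have hmem : OnePoint.continuousMapMk ⟨f, hf⟩ 0 h0 ∈
      (onePointResolventAlgebra X).topologicalClosure := htop ▸ StarSubalgebra.mem_top
  have hmem' : OnePoint.continuousMapMk ⟨f, hf⟩ 0 h0 ∈ onePointResolventAlgebra X :=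
    isClosed_onePointResolventAlgebra.closure_subset hmem
  exact ⟨restrictOnePoint (OnePoint.continuousMapMk ⟨f, hf⟩ 0 h0), hmem', rfl⟩

theorem ResolventVector.of_tendsto_zero [FiniteDimensional ℝ X] {f : X → Y}
    (hf : Continuous f) (h0 : Tendsto f (cocompact X) (𝓝 0)) : ResolventVector f := fun y => by
  refine mem_resolventFunctions_of_tendsto_zero (by fun_prop) ?_
  have h1 : Continuous fun v : Y => ((inner ℝ y v : ℝ) : ℂ) := by fun_prop
  simpa [Function.comp_def] using (h1.tendsto 0).comp h0

end Algebra

/-! ### Time averages along linear flows -/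

section Averages

open MeasureTheory

variable {X Y W : Type*} [NormedAddCommGroup X] [InnerProductSpace ℝ X] [NormedAddCommGroup Y] [InnerProductSpace ℝ Y] [FiniteDimensional ℝ Y]
  [NormedAddCommGroup W] [InnerProductSpace ℝ W]
  {C : ℝ → W →L[ℝ] X} {M : ℝ → Y →L[ℝ] W} {G : W → W} {κ : ℝ}

omit [FiniteDimensional ℝ Y] in
theorem norm_integrand_le (hκ : ∀ w, ‖G w‖ ≤ κ) (s : ℝ) (y : Y) :
    ‖C s (G (M s y))‖ ≤ ‖C s‖ * κ :=
  ((C s).le_opNorm _).trans (by gcongr; exact hκ _)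

omit [FiniteDimensional ℝ Y] in
theorem continuous_average (hC : Continuous C) (hM : Continuous M) (hG : Continuous G)
    (a b : ℝ) : Continuous fun y => ∫ s in a..b, C s (G (M s y)) :=
  intervalIntegral.continuous_parametric_intervalIntegral_of_continuous' (by fun_prop) a b

omit [FiniteDimensional ℝ Y] in
/-- Averages of a function vanishing at infinity decay along every direction that is almost surely
not annihilated. -/
theorem tendsto_average_ray (hC : Continuous C) (hM : Continuous M) (hG : Continuous G)
    (hκ : ∀ w, ‖G w‖ ≤ κ) (h0 : Tendsto G (Bornology.cobounded W) (𝓝 0)) {u : Y}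
    (hu : ∀ᵐ s, M s u ≠ 0) (a b : ℝ) :
    Tendsto (fun p : ℝ × Y => ∫ s in a..b, C s (G (M s (p.1 • p.2)))) (atTop ×ˢ 𝓝 u) (𝓝 0) := by
  have key : Tendsto (fun p : ℝ × Y => ∫ s in a..b, C s (G (M s (p.1 • p.2)))) (atTop ×ˢ 𝓝 u)
      (𝓝 (∫ _s in a..b, (0 : X))) := by
    refine intervalIntegral.tendsto_integral_filter_of_dominated_convergence
      (fun s => ‖C s‖ * κ) ?_ ?_ ?_ ?_
    · refine Eventually.of_forall fun p => Continuous.aestronglyMeasurable ?_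
      fun_prop
    · exact Eventually.of_forall fun p => Eventually.of_forall fun s _ =>
        norm_integrand_le hκ s _
    · exact Continuous.intervalIntegrable (by fun_prop) _ _
    -- For almost every `s` the argument of `G` has norm `|p.1| * ‖M s p.2‖`, which tends to
    -- infinity.
    · filter_upwards [hu] with s hs _
      have h1 : Tendsto (fun p : ℝ × Y => M s (p.1 • p.2)) (atTop ×ˢ 𝓝 u)
          (Bornology.cobounded W) := by
        rw [← tendsto_norm_atTop_iff_cobounded]
        have h2 : Tendsto (fun p : ℝ × Y => ‖M s p.2‖) (atTop ×ˢ 𝓝 u) (𝓝 ‖M s u‖) :=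
          (((M s).continuous.norm).tendsto u).comp tendsto_snd
        have h3 : Tendsto (fun p : ℝ × Y => |p.1|) (atTop ×ˢ 𝓝 u) atTop :=
          tendsto_abs_atTop_atTop.comp tendsto_fst
        refine (h3.atTop_mul_pos (norm_pos_iff.2 hs) h2).congr fun p => ?_
        rw [map_smul, norm_smul, Real.norm_eq_abs]
      simpa [Function.comp_def] using ((C s).continuous.tendsto 0).comp (h0.comp h1)
  simpa using key

/-- Averages of a function vanishing at infinity vanish at infinity if no direction is
annihilated. -/
theorem tendsto_average (hC : Continuous C) (hM : Continuous M) (hG : Continuous G)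
    (hκ : ∀ w, ‖G w‖ ≤ κ) (h0 : Tendsto G (Bornology.cobounded W) (𝓝 0))
    (hu : ∀ u : Y, u ≠ 0 → ∀ᵐ s, M s u ≠ 0) (a b : ℝ) :
    Tendsto (fun y => ∫ s in a..b, C s (G (M s y))) (cocompact Y) (𝓝 0) := by
  have : ProperSpace Y := FiniteDimensional.proper_real Y
  rw [Metric.tendsto_nhds]
  intro ε hε
  -- Decay along rays holds on a neighbourhood of each direction; compactness of the unit sphere
  -- makes it uniform.
  have hS : {p : ℝ × Y | dist (∫ s in a..b, C s (G (M s (p.1 • p.2)))) 0 < ε} ∈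
      (atTop : Filter ℝ) ×ˢ 𝓝ˢ (Metric.sphere (0 : Y) 1) := by
    refine (isCompact_sphere (0 : Y) 1).mem_prod_nhdsSet_of_forall fun u hu1 => ?_
    have hu0 : u ≠ 0 := by
      rintro rfl
      simp at hu1
    exact (Metric.tendsto_nhds.1 (tendsto_average_ray hC hM hG hκ h0 (hu u hu0) a b)) ε hε
  obtain ⟨t, ht, v, hv, htv⟩ := mem_prod_iff.1 hS
  have hvS : Metric.sphere (0 : Y) 1 ⊆ v := subset_of_mem_nhdsSet hv
  have hnorm := tendsto_norm_cocompact_atTop (E := Y)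
  filter_upwards [hnorm.eventually ht, hnorm.eventually_gt_atTop 0] with y hy hy0
  have := @htv (‖y‖, ‖y‖⁻¹ • y) ⟨hy, hvS (by simp [norm_smul, hy0.ne'])⟩
  simpa [smul_smul, hy0.ne'] using this

/-- Averages of a function vanishing at infinity along a family of linear maps for which every
direction is either always or almost never annihilated belong to the resolvent algebra. -/
theorem ResolventVector.average (hC : Continuous C) (hM : Continuous M) (hG : Continuous G)
    (hκ : ∀ w, ‖G w‖ ≤ κ) (h0 : Tendsto G (Bornology.cobounded W) (𝓝 0))
    (hu : ∀ u : Y, (∀ s, M s u = 0) ∨ ∀ᵐ s, M s u ≠ 0) (a b : ℝ) :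
    ResolventVector fun y => ∫ s in a..b, C s (G (M s y)) := by
  -- The average depends only on the component orthogonal to the common kernel `U`, and no nonzero
  -- vector of `Uᗮ` is annihilated for all `s`.
  let U : Submodule ℝ Y := ⨅ s, LinearMap.ker (M s : Y →ₗ[ℝ] W)
  have hmemU : ∀ u, u ∈ U ↔ ∀ s, M s u = 0 := fun u => by simp [U, Submodule.mem_iInf]
  let ι : Uᗮ →L[ℝ] Y := Uᗮ.subtypeL
  have hP : ∀ (s : ℝ) (y : Y), M s (ι (Uᗮ.orthogonalProjectionOnto y)) = M s y := by
    intro s y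
    have h1 : y - ι (Uᗮ.orthogonalProjectionOnto y) ∈ U := by
      have h2 := Uᗮ.sub_starProjection_mem_orthogonal y
      rwa [Submodule.orthogonal_orthogonal] at h2
    have h3 := (hmemU _).1 h1 s
    rw [map_sub, sub_eq_zero] at h3
    exact h3.symm
  have hι : Continuous fun s => (M s).comp ι := by fun_prop
  have hK : ResolventVector fun v : Uᗮ => ∫ s in a..b, C s (G ((M s).comp ι v)) := by
    refine ResolventVector.of_tendsto_zero (continuous_average hC hι hG a b)
      (tendsto_average hC hι hG hκ h0 (fun u hu0 => ?_) a b)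
    refine (hu (ι u)).resolve_left fun h => hu0 ?_
    have h1 : (u : Y) ∈ U := (hmemU _).2 h
    have h2 : (u : Y) ∈ U ⊓ Uᗮ := ⟨h1, u.2⟩
    rw [Submodule.inf_orthogonal_eq_bot, Submodule.mem_bot] at h2
    exact Subtype.ext h2
  intro x
  have := comp_linear_mem_resolventFunctions Uᗮ.orthogonalProjectionOnto (hK x)
  simpa only [ContinuousLinearMap.comp_apply, hP] using this

variable {E : Type*} [NormedAddCommGroup E] [NormedSpace ℝ E] [CompleteSpace E]

theorem analyticOnNhd_exp_smul_apply (A : E →L[ℝ] E) (Q : E →L[ℝ] W) (u : E) :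
    AnalyticOnNhd ℝ (fun s : ℝ => Q (NormedSpace.exp (s • A) u)) Set.univ := by
  intro s _
  have h1 : AnalyticAt ℝ (fun s : ℝ => s • A) s := analyticAt_id.smul analyticAt_const
  have h2 : AnalyticAt ℝ (fun s : ℝ => NormedSpace.exp (s • A)) s :=
    AnalyticAt.fun_comp (NormedSpace.exp_analytic (𝕂 := ℝ) (s • A)) h1
  exact AnalyticAt.fun_comp (g := Q.comp (ContinuousLinearMap.apply ℝ E u))
    (ContinuousLinearMap.analyticAt _ _) h2

/-- The zeros of a real-analytic function that is not identically zero are isolated, hence form a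
null set. -/
theorem forall_or_ae_exp_smul_apply (A : E →L[ℝ] E) (Q : E →L[ℝ] W) (u : E) :
    (∀ s : ℝ, Q (NormedSpace.exp (s • A) u) = 0) ∨
      ∀ᵐ s : ℝ, Q (NormedSpace.exp (s • A) u) ≠ 0 := by
  by_cases h : ∀ s : ℝ, Q (NormedSpace.exp (s • A) u) = 0
  · exact Or.inl h
  · push Not at h
    obtain ⟨s, hs⟩ := h
    right
    have h1 := (analyticOnNhd_exp_smul_apply A Q u).preimage_zero_mem_codiscrete hs
    have h2 := ae_restrict_le_codiscreteWithin (μ := volume) (MeasurableSet.univ (α := ℝ)) h1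
    rw [Measure.restrict_univ] at h2
    filter_upwards [h2] with t ht using ht

end Averages

/-! ### Flows of perturbed linear vector fields -/

section Dynamics

variable {X : Type*} [NormedAddCommGroup X] [InnerProductSpace ℝ X] [FiniteDimensional ℝ X]

/-- One Euler step: if the displacement at time `t` is approximated up to `δ` by a function with
components in the resolvent algebra, then so is the displacement at time `t + h`, up to a controlled
error. -/
theorem euler_step {F Ψ : ℝ → X → X} {T M L : ℝ} (hF : Continuous fun p : ℝ × X => F p.1 p.2)
    (hM : ∀ s ∈ Set.Icc 0 T, ∀ x, ‖F s x‖ ≤ M) (hL0 : 0 ≤ L) (hM0 : 0 ≤ M)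
    (hL : ∀ s ∈ Set.Icc 0 T, ∀ x y, ‖F s x - F s y‖ ≤ L * ‖x - y‖)
    (hav : ∀ a b, ResolventVector fun x => ∫ s in a..b, F s x)
    (hΨ : ∀ x t, HasDerivAt (fun s => Ψ s x) (F t (Ψ t x)) t)
    {t h δ : ℝ} (ht : 0 ≤ t) (hh : 0 ≤ h) (hT : t + h ≤ T)
    (hE : ∃ E : X → X, ResolventVector E ∧ ∀ x, ‖Ψ t x - x - E x‖ ≤ δ) :
    ∃ E : X → X, ResolventVector E ∧
      ∀ x, ‖Ψ (t + h) x - x - E x‖ ≤ δ * (1 + L * h) + L * M * h ^ 2 := by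
  obtain ⟨E, hE, hEδ⟩ := hE
  -- The field is frozen at the approximate position `x + E x`, so the increment is a time average
  -- composed with `id + E`.
  refine ⟨fun x => E x + ∫ s in t..(t + h), F s (x + E x),
    hE.add (hE.comp (ContinuousLinearMap.id ℝ X) (hav t (t + h))), fun x => ?_⟩
  have hΨc : Continuous fun s => Ψ s x :=
    continuous_iff_continuousAt.2 fun s => (hΨ x s).continuousAt
  have hc1 : Continuous fun s => F s (Ψ s x) := hF.comp (continuous_id.prodMk hΨc)
  have hc2 : Continuous fun s => F s (x + E x) := hF.comp (continuous_id.prodMk continuous_const)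
  have hint : ∫ s in t..(t + h), F s (Ψ s x) = Ψ (t + h) x - Ψ t x :=
    intervalIntegral.integral_eq_sub_of_hasDerivAt (fun s _ => hΨ x s)
      (hc1.intervalIntegrable _ _)
  have hsplit : Ψ (t + h) x - x - (E x + ∫ s in t..(t + h), F s (x + E x)) =
      (Ψ t x - x - E x) + ∫ s in t..(t + h), (F s (Ψ s x) - F s (x + E x)) := by
    rw [intervalIntegral.integral_sub (hc1.intervalIntegrable _ _) (hc2.intervalIntegrable _ _),
      hint]
    abel
  have hΨt : ∀ s ∈ Set.Icc t (t + h), ‖Ψ s x - Ψ t x‖ ≤ M * (s - t) :=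
    norm_image_sub_le_of_norm_deriv_le_segment'
      (fun s _ => (hΨ x s).hasDerivWithinAt)
      (fun s hs => hM s ⟨ht.trans hs.1, hs.2.le.trans hT⟩ _)
  -- During the step the true orbit moves at most `M * h` and starts within `δ` of the frozen point.
  have hbound : ‖∫ s in t..(t + h), (F s (Ψ s x) - F s (x + E x))‖ ≤
      L * (M * h + δ) * |t + h - t| := by
    refine intervalIntegral.norm_integral_le_of_norm_le_const fun s hs => ?_
    rw [Set.uIoc_of_le (by linarith)] at hs
    refine (hL s ⟨ht.trans hs.1.le, hs.2.trans hT⟩ _ _).trans ?_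
    gcongr
    have h1 := hΨt s ⟨hs.1.le, hs.2⟩
    have h2 : M * (s - t) ≤ M * h := by gcongr; linarith [hs.2]
    calc ‖Ψ s x - (x + E x)‖ = ‖(Ψ s x - Ψ t x) + (Ψ t x - x - E x)‖ := by congr 1; abel
      _ ≤ ‖Ψ s x - Ψ t x‖ + ‖Ψ t x - x - E x‖ := norm_add_le _ _
      _ ≤ M * h + δ := add_le_add (h1.trans h2) (hEδ x)
  rw [hsplit]
  refine (norm_add_le _ _).trans ((add_le_add (hEδ x) hbound).trans (le_of_eq ?_))
  rw [add_sub_cancel_left, abs_of_nonneg hh]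
  ring

/-- The displacement of a non-autonomous flow has components in the resolvent algebra if the time
averages of the vector field do. -/
theorem ResolventVector.displacement {F Ψ : ℝ → X → X} {T M L : ℝ}
    (hF : Continuous fun p : ℝ × X => F p.1 p.2)
    (hM : ∀ s ∈ Set.Icc 0 T, ∀ x, ‖F s x‖ ≤ M) (hL0 : 0 ≤ L) (hM0 : 0 ≤ M)
    (hL : ∀ s ∈ Set.Icc 0 T, ∀ x y, ‖F s x - F s y‖ ≤ L * ‖x - y‖)
    (hav : ∀ a b, ResolventVector fun x => ∫ s in a..b, F s x) (hΨ0 : ∀ x, Ψ 0 x = x)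
    (hΨ : ∀ x t, HasDerivAt (fun s => Ψ s x) (F t (Ψ t x)) t) (hT : 0 ≤ T) :
    ResolventVector fun x => Ψ T x - x := by
  -- The bound solves `δ_{i+1} = δ_i (1 + L h) + L M h²` with `δ_0 = 0`. For `h = T / k`, `i = k` it
  -- is at most `M T e^{LT} / k`.
  have hstep : ∀ h : ℝ, 0 ≤ h → ∀ i : ℕ, i * h ≤ T → ∃ E : X → X, ResolventVector E ∧
      ∀ x, ‖Ψ (i * h) x - x - E x‖ ≤ M * h * ((1 + L * h) ^ i - 1) := by
    intro h hh i
    induction i with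
    | zero =>
      intro _
      refine ⟨fun _ => 0, ResolventVector.zero, fun x => ?_⟩
      simp [hΨ0]
    | succ i ih =>
      intro hi
      have hi' : (i : ℝ) * h + h ≤ T := by
        push_cast at hi
        linarith
      obtain ⟨E, hE, hEx⟩ := euler_step hF hM hL0 hM0 hL hav hΨ (by positivity) hh hi'
        (ih (by linarith))
      refine ⟨E, hE, fun x => ?_⟩
      have h1 : ((i + 1 : ℕ) : ℝ) * h = i * h + h := by push_cast; ring
      rw [h1]
      refine (hEx x).trans (le_of_eq ?_)
      ring
  refine ResolventVector.of_uniform_limit fun ε hε => ?_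
  have hlim : Tendsto (fun k : ℕ => M * T * Real.exp (L * T) / (k : ℝ)) atTop (𝓝 0) :=
    tendsto_const_div_atTop_nhds_zero_nat _
  obtain ⟨k, hk, hk0⟩ := ((hlim.eventually_lt_const hε).and (eventually_gt_atTop 0)).exists
  have hk0' : (0 : ℝ) < k := by exact_mod_cast hk0
  have hkT : (k : ℝ) * (T / k) = T := by field_simp
  obtain ⟨E, hE, hEx⟩ := hstep (T / k) (by positivity) k hkT.le
  refine ⟨E, hE, fun x => ?_⟩
  have h1 := hEx x
  rw [hkT] at h1
  refine h1.trans (le_trans ?_ hk.le)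
  have h2 : (1 + L * (T / k)) ^ k ≤ Real.exp (L * T) := by
    calc (1 + L * (T / k)) ^ k ≤ Real.exp (L * (T / k)) ^ k := by
          gcongr
          linarith [Real.add_one_le_exp (L * (T / k))]
      _ = Real.exp (L * T) := by
          rw [← Real.exp_nat_mul]
          congr 1
          field_simp
  calc M * (T / k) * ((1 + L * (T / k)) ^ k - 1) ≤ M * (T / k) * Real.exp (L * T) := by
        gcongr
        linarith
    _ = M * T * Real.exp (L * T) / k := by ring

/-- Perturbations of linear vector fields whose dynamics preserve the resolvent algebra: bounded
Lipschitz vector fields whose time averages along linear flows have components in the resolvent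
algebra. -/
structure AdmissiblePerturbation (B : X → X) : Prop where
  lipschitz : ∃ K : ℝ≥0, LipschitzWith K B
  bounded : ∃ κ : ℝ, ∀ x, ‖B x‖ ≤ κ
  average : ∀ (A : X →L[ℝ] X) (a b : ℝ), ResolventVector fun x =>
    ∫ s in a..b, NormedSpace.exp (-s • A) (B (NormedSpace.exp (s • A) x))

theorem continuous_exp_smul (A : X →L[ℝ] X) :
    Continuous fun s : ℝ => NormedSpace.exp (s • A) := by
  let +nondep : NormedAlgebra ℚ (X →L[ℝ] X) := .restrictScalars ℚ ℝ _
  exact (NormedSpace.exp_continuous (𝔸 := X →L[ℝ] X)).comp (by fun_prop)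

theorem continuous_interaction (A : X →L[ℝ] X) {B : X → X} (hB : Continuous B) :
    Continuous fun p : ℝ × X =>
      NormedSpace.exp (-p.1 • A) (B (NormedSpace.exp (p.1 • A) p.2)) := by
  have h1 : Continuous fun p : ℝ × X => NormedSpace.exp (p.1 • A) :=
    (continuous_exp_smul A).comp continuous_fst
  have h2 : Continuous fun p : ℝ × X => NormedSpace.exp (-p.1 • A) :=
    (continuous_exp_smul A).comp continuous_fst.neg
  fun_prop

omit [FiniteDimensional ℝ X] in
theorem AdmissiblePerturbation.continuous {B : X → X} (hB : AdmissiblePerturbation B) :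
    Continuous B :=
  hB.lipschitz.choose_spec.continuous

omit [FiniteDimensional ℝ X] in
theorem AdmissiblePerturbation.zero : AdmissiblePerturbation (fun _ : X => (0 : X)) where
  lipschitz := ⟨0, LipschitzWith.const 0⟩
  bounded := ⟨0, fun x => by simp⟩
  average A a b := by simpa using ResolventVector.zero

theorem AdmissiblePerturbation.add {B B' : X → X} (hB : AdmissiblePerturbation B)
    (hB' : AdmissiblePerturbation B') : AdmissiblePerturbation fun x => B x + B' x where
  lipschitz := by
    obtain ⟨K, hK⟩ := hB.lipschitz
    obtain ⟨K', hK'⟩ := hB'.lipschitz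
    exact ⟨K + K', hK.add hK'⟩
  bounded := by
    obtain ⟨κ, hκ⟩ := hB.bounded
    obtain ⟨κ', hκ'⟩ := hB'.bounded
    exact ⟨κ + κ', fun x => (norm_add_le _ _).trans (add_le_add (hκ x) (hκ' x))⟩
  average A a b := by
    have h1 : ∀ {B : X → X}, Continuous B → ∀ x, IntervalIntegrable
        (fun s => NormedSpace.exp (-s • A) (B (NormedSpace.exp (s • A) x)))
        MeasureTheory.volume a b := fun hB x =>
      ((continuous_interaction A hB).comp (continuous_id.prodMk continuous_const)
        ).intervalIntegrable _ _
    simp only [map_add]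
    simp_rw [fun x => intervalIntegral.integral_add (h1 hB.continuous x) (h1 hB'.continuous x)]
    exact (hB.average A a b).add (hB'.average A a b)

omit [FiniteDimensional ℝ X] in
theorem AdmissiblePerturbation.neg {B : X → X} (hB : AdmissiblePerturbation B) :
    AdmissiblePerturbation fun x => -B x where
  lipschitz := by
    obtain ⟨K, hK⟩ := hB.lipschitz
    exact ⟨K, hK.neg⟩
  bounded := by simpa using hB.bounded
  average A a b y := by simpa using hB.average A a b (-y)

theorem AdmissiblePerturbation.sum {ι : Type*} (s : Finset ι) {B : ι → X → X}
    (hB : ∀ i ∈ s, AdmissiblePerturbation (B i)) :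
    AdmissiblePerturbation fun x => ∑ i ∈ s, B i x := by
  classical
  induction s using Finset.induction_on with
  | empty => simpa using AdmissiblePerturbation.zero
  | insert i s hi ih =>
    simp only [Finset.sum_insert hi]
    exact (hB i (Finset.mem_insert_self i s)).add
      (ih fun j hj => hB j (Finset.mem_insert_of_mem hj))

/-- A Lipschitz vector field vanishing at infinity, pulled back along a linear map. -/
theorem AdmissiblePerturbation.of_tendsto_zero {W : Type*} [NormedAddCommGroup W]
    [InnerProductSpace ℝ W] {G : W → W} {K : ℝ≥0} {κ : ℝ} (hG : LipschitzWith K G)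
    (hκ : ∀ w, ‖G w‖ ≤ κ) (h0 : Tendsto G (Bornology.cobounded W) (𝓝 0))
    (J : W →L[ℝ] X) (Q : X →L[ℝ] W) : AdmissiblePerturbation fun x => J (G (Q x)) where
  lipschitz := ⟨_, J.lipschitz.comp (hG.comp Q.lipschitz)⟩
  bounded := ⟨‖J‖ * κ, fun x => (J.le_opNorm _).trans (by gcongr; exact hκ _)⟩
  average A a b := by
    have h1 := continuous_exp_smul A
    have h2 : Continuous fun s : ℝ => NormedSpace.exp (-s • A) := h1.comp continuous_neg
    exact ResolventVector.average (C := fun s => (NormedSpace.exp (-s • A)).comp J)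
      (M := fun s => Q.comp (NormedSpace.exp (s • A))) (by fun_prop) (by fun_prop) hG.continuous
      hκ h0 (fun u => forall_or_ae_exp_smul_apply A Q u) a b

theorem exp_smul_apply_exp_neg_smul (A : X →L[ℝ] X) (t : ℝ) (x : X) :
    NormedSpace.exp (t • A) (NormedSpace.exp (-t • A) x) = x := by
  let +nondep : NormedAlgebra ℚ (X →L[ℝ] X) := .restrictScalars ℚ ℝ _
  have h : NormedSpace.exp (t • A) * NormedSpace.exp (-t • A) = 1 := by
    rw [← NormedSpace.exp_add_of_commute, neg_smul, add_neg_cancel, NormedSpace.exp_zero]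
    exact ((Commute.refl A).smul_left t).smul_right (-t)
  exact DFunLike.congr_fun h x

theorem hasDerivAt_exp_smul_apply (A : X →L[ℝ] X) {x : ℝ → X} {x' : X} {t : ℝ}
    (hx : HasDerivAt x x' t) :
    HasDerivAt (fun s => NormedSpace.exp (s • A) (x s))
      (A (NormedSpace.exp (t • A) (x t)) + NormedSpace.exp (t • A) x') t := by
  have h := (hasDerivAt_exp_smul_const' (𝕂 := ℝ) A t).clm_apply hx
  simpa using h

/-- Variation of constants: `A` commutes with its exponential, so the linear term cancels. -/
theorem hasDerivAt_exp_neg_smul_apply (A : X →L[ℝ] X) {x : ℝ → X} {v : X} {t : ℝ}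
    (hx : HasDerivAt x (A (x t) + v) t) :
    HasDerivAt (fun s => NormedSpace.exp (-s • A) (x s)) (NormedSpace.exp (-t • A) v) t := by
  have h := hasDerivAt_exp_smul_apply (-A) hx
  have hcomm : NormedSpace.exp (-t • A) (A (x t)) = A (NormedSpace.exp (-t • A) (x t)) := by
    have : Commute (NormedSpace.exp (-t • A)) A := ((Commute.refl A).smul_left _).exp_left
    exact DFunLike.congr_fun this (x t)
  simp only [smul_neg, ← neg_smul] at h
  convert h using 1
  rw [map_add, hcomm, neg_apply, neg_add_cancel_left]

omit [FiniteDimensional ℝ X] in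
theorem norm_exp_le_exp_norm (A : X →L[ℝ] X) : ‖NormedSpace.exp A‖ ≤ Real.exp ‖A‖ := by
  have h1 : HasSum (fun k : ℕ => ‖A‖ ^ k / (k.factorial : ℝ)) (Real.exp ‖A‖) := by
    rw [Real.exp_eq_exp_ℝ]
    exact NormedSpace.expSeries_div_hasSum_exp ‖A‖
  rw [NormedSpace.exp_eq_tsum ℝ]
  refine tsum_of_norm_bounded h1 fun k => ?_
  have h2 : ‖A ^ k‖ ≤ ‖A‖ ^ k := by
    -- The identity of a trivial space has norm 0, so the zeroth power only satisfies `‖1‖ ≤ 1`.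
    rcases Nat.eq_zero_or_pos k with rfl | hk
    · simpa using! ContinuousLinearMap.norm_id_le (𝕜 := ℝ) (E := X)
    · exact norm_pow_le' A hk
  rw [norm_smul, norm_inv, Real.norm_natCast, div_eq_inv_mul]
  gcongr

omit [FiniteDimensional ℝ X] in
theorem norm_exp_smul_le (A : X →L[ℝ] X) {s T : ℝ} (hs : |s| ≤ T) :
    ‖NormedSpace.exp (s • A)‖ ≤ Real.exp (T * ‖A‖) := by
  refine (norm_exp_le_exp_norm _).trans (Real.exp_le_exp.2 ?_)
  rw [norm_smul, Real.norm_eq_abs]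
  gcongr

theorem norm_interaction_le (A : X →L[ℝ] X) {B : X → X} {κ : ℝ} (hκ : ∀ x, ‖B x‖ ≤ κ)
    {s T : ℝ} (hs : |s| ≤ T) (x : X) :
    ‖NormedSpace.exp (-s • A) (B (NormedSpace.exp (s • A) x))‖ ≤ Real.exp (T * ‖A‖) * κ := by
  refine (ContinuousLinearMap.le_opNorm _ _).trans ?_
  gcongr
  · exact norm_exp_smul_le A (by rwa [abs_neg])
  · exact hκ _

theorem norm_interaction_sub_le (A : X →L[ℝ] X) {B : X → X} {K : ℝ≥0} (hK : LipschitzWith K B)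
    {s T : ℝ} (hs : |s| ≤ T) (x y : X) :
    ‖NormedSpace.exp (-s • A) (B (NormedSpace.exp (s • A) x)) -
      NormedSpace.exp (-s • A) (B (NormedSpace.exp (s • A) y))‖ ≤
      Real.exp (T * ‖A‖) * (K * Real.exp (T * ‖A‖)) * ‖x - y‖ := by
  rw [← map_sub, mul_assoc, mul_assoc]
  refine (ContinuousLinearMap.le_opNorm _ _).trans ?_
  gcongr
  · exact norm_exp_smul_le A (by rwa [abs_neg])
  · refine (hK.norm_sub_le _ _).trans ?_
    rw [← map_sub]
    gcongr
    refine (ContinuousLinearMap.le_opNorm _ _).trans ?_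
    gcongr
    exact norm_exp_smul_le A hs

/-- The flow of an admissible perturbation of a linear vector field preserves the resolvent algebra
at positive times. -/
theorem AdmissiblePerturbation.comp_flow_mem_of_nonneg {B : X → X}
    (hB : AdmissiblePerturbation B) (A : X →L[ℝ] X) {Φ : ℝ → X → X} (h0 : ∀ x, Φ 0 x = x)
    (hΦ : ∀ x t, HasDerivAt (fun s => Φ s x) (A (Φ t x) + B (Φ t x)) t) {T : ℝ} (hT : 0 ≤ T)
    {f : X → ℂ} (hf : f ∈ resolventFunctions X) : f ∘ Φ T ∈ resolventFunctions X := by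
  obtain ⟨K, hK⟩ := hB.lipschitz
  obtain ⟨κ, hκ⟩ := hB.bounded
  have hκ0 : 0 ≤ κ := (norm_nonneg _).trans (hκ 0)
  have habs : ∀ s ∈ Set.Icc 0 T, |s| ≤ T := fun s hs => by rw [abs_of_nonneg hs.1]; exact hs.2
  have hD : ResolventVector fun x => NormedSpace.exp (-T • A) (Φ T x) - x := by
    refine ResolventVector.displacement (Ψ := fun t x => NormedSpace.exp (-t • A) (Φ t x))
      (continuous_interaction A hB.continuous)
      (fun s hs x => norm_interaction_le A hκ (habs s hs) x) (by positivity) (by positivity)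
      (fun s hs x y => norm_interaction_sub_le A hK (habs s hs) x y)
      (fun a b => hB.average A a b) (fun x => by simp [h0]) (fun x t => ?_) hT
    have h1 := hasDerivAt_exp_neg_smul_apply A (hΦ x t)
    simpa only [exp_smul_apply_exp_neg_smul] using h1
  -- `Φ T x = e^{TA} (x + D x)`: the linear map is pulled back first, then `id + D`.
  have h1 := comp_linear_mem_resolventFunctions (NormedSpace.exp (T • A)) hf
  have h2 := hD.comp_mem_resolventFunctions (ContinuousLinearMap.id ℝ X) h1
  simpa [exp_smul_apply_exp_neg_smul, Function.comp_def, -neg_smul] using h2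

theorem AdmissiblePerturbation.comp_flow_mem {B : X → X}
    (hB : AdmissiblePerturbation B) (A : X →L[ℝ] X) {Φ : ℝ → X → X} (h0 : ∀ x, Φ 0 x = x)
    (hΦ : ∀ x t, HasDerivAt (fun s => Φ s x) (A (Φ t x) + B (Φ t x)) t) (t : ℝ)
    {f : X → ℂ} (hf : f ∈ resolventFunctions X) : f ∘ Φ t ∈ resolventFunctions X := by
  rcases le_total 0 t with ht | ht
  · exact hB.comp_flow_mem_of_nonneg A h0 hΦ ht hf
  -- The reversed flow belongs to `-A` and `-B`; admissibility covers every linear part.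
  · have h1 := hB.neg.comp_flow_mem_of_nonneg (-A) (Φ := fun s => Φ (-s)) (by simpa using h0)
      (fun x s => ?_) (neg_nonneg.2 ht) hf
    · simpa using h1
    · have h2 := (hΦ x (-s)).scomp s (hasDerivAt_neg s)
      simpa [Function.comp_def, add_comm] using h2

omit [FiniteDimensional ℝ X] in
theorem AdmissiblePerturbation.lipschitz_field {B : X → X} (hB : AdmissiblePerturbation B)
    (A : X →L[ℝ] X) : ∃ K : ℝ≥0, LipschitzWith K fun x => A x + B x := by
  obtain ⟨K, hK⟩ := hB.lipschitz
  exact ⟨_, A.lipschitz.add hK⟩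

omit [FiniteDimensional ℝ X] in
theorem eq_of_global_solutions {v : X → X} {K : ℝ≥0} (hv : LipschitzWith K v) {γ γ' : ℝ → X}
    (hγ : ∀ t, HasDerivAt γ (v (γ t)) t) (hγ' : ∀ t, HasDerivAt γ' (v (γ' t)) t) {t₀ : ℝ}
    (h0 : γ t₀ = γ' t₀) : γ = γ' :=
  ODE_solution_unique_univ (v := fun _ => v) (s := fun _ => Set.univ) (K := K)
    (fun _ => hv.lipschitzOnWith) (fun t => ⟨hγ t, trivial⟩) (fun t => ⟨hγ' t, trivial⟩) h0

theorem AdmissiblePerturbation.image_comp_flow {B : X → X}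
    (hB : AdmissiblePerturbation B) (A : X →L[ℝ] X) {Φ : ℝ → X → X} (h0 : ∀ x, Φ 0 x = x)
    (hΦ : ∀ x t, HasDerivAt (fun s => Φ s x) (A (Φ t x) + B (Φ t x)) t) (t : ℝ) :
    (fun f : X → ℂ => f ∘ Φ t) '' resolventFunctions X = resolventFunctions X := by
  apply Set.Subset.antisymm
  · rintro _ ⟨f, hf, rfl⟩
    exact hB.comp_flow_mem A h0 hΦ t hf
  · intro f hf
    refine ⟨f ∘ Φ (-t), hB.comp_flow_mem A h0 hΦ (-t) hf, ?_⟩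
    funext x
    obtain ⟨K, hK⟩ := hB.lipschitz_field A
    -- The group property, from uniqueness of solutions.
    have h1 : (fun s => Φ (s + t) x) = fun s => Φ s (Φ t x) :=
      eq_of_global_solutions hK (t₀ := 0) (fun s => (hΦ x (s + t)).comp_add_const s t)
        (fun s => hΦ _ s) (by simp [h0])
    have h2 := congrFun h1 (-t)
    simp only [neg_add_cancel, h0] at h2
    simp [← h2]

omit [FiniteDimensional ℝ X] in
/-- Solutions on all bounded intervals yield a global solution. -/
theorem exists_global_solution {v : X → X} {K : ℝ≥0} (hv : LipschitzWith K v) (x₀ : X)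
    (h : ∀ T : ℝ, 0 < T → ∃ γ : ℝ → X, γ 0 = x₀ ∧
      ∀ t ∈ Set.Ioo (-T) T, HasDerivAt γ (v (γ t)) t) :
    ∃ γ : ℝ → X, γ 0 = x₀ ∧ ∀ t, HasDerivAt γ (v (γ t)) t := by
  have h' : ∀ k : ℕ, ∃ γ : ℝ → X, γ 0 = x₀ ∧
      ∀ t ∈ Set.Ioo (-(k + 1 : ℝ)) (k + 1), HasDerivAt γ (v (γ t)) t :=
    fun k => h (k + 1) (by positivity)
  choose γ hγ0 hγ using h'
  have hle : ∀ j k : ℕ, j ≤ k → Set.EqOn (γ j) (γ k) (Set.Ioo (-(j + 1 : ℝ)) (j + 1)) := by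
    intro j k hjk
    have hjk' : (j : ℝ) ≤ k := by exact_mod_cast hjk
    refine ODE_solution_unique_of_mem_Ioo (v := fun _ => v) (s := fun _ => Set.univ) (K := K)
      (t₀ := 0) (fun _ _ => hv.lipschitzOnWith) ⟨?_, ?_⟩ (fun t ht => ⟨hγ j t ht, trivial⟩)
      (fun t ht => ⟨hγ k t ⟨?_, ?_⟩, trivial⟩) ((hγ0 j).trans (hγ0 k).symm)
    · have : (0 : ℝ) ≤ j := j.cast_nonneg
      linarith
    · positivity
    · linarith [ht.1]
    · linarith [ht.2]
  have heq : ∀ j k : ℕ, ∀ t : ℝ, |t| < j + 1 → |t| < k + 1 → γ j t = γ k t := by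
    intro j k t hj hk
    rw [abs_lt] at hj hk
    rcases le_total j k with hjk | hjk
    · exact hle j k hjk hj
    · exact (hle k j hjk hk).symm
  -- The strict inequality lets one and the same local solution serve on a neighbourhood of `t`.
  have hceil : ∀ t : ℝ, |t| < (⌈|t|⌉₊ : ℝ) + 1 := fun t =>
    (Nat.le_ceil _).trans_lt (lt_add_one _)
  refine ⟨fun t => γ ⌈|t|⌉₊ t, hγ0 _, fun t => ?_⟩
  refine (hγ ⌈|t|⌉₊ t (abs_lt.1 (hceil t))).congr_of_eventuallyEq ?_
  filter_upwards [(continuous_abs.tendsto t).eventually_lt_const (hceil t)] with s hs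
  exact heq _ _ s (hceil s) hs

theorem AdmissiblePerturbation.exists_solution {B : X → X} (hB : AdmissiblePerturbation B)
    (A : X →L[ℝ] X) (x₀ : X) :
    ∃ γ : ℝ → X, γ 0 = x₀ ∧ ∀ t, HasDerivAt γ (A (γ t) + B (γ t)) t := by
  obtain ⟨K', hK'⟩ := hB.lipschitz_field A
  obtain ⟨K, hK⟩ := hB.lipschitz
  obtain ⟨κ, hκ⟩ := hB.bounded
  have hκ0 : 0 ≤ κ := (norm_nonneg _).trans (hκ 0)
  refine exists_global_solution hK' x₀ fun T hT => ?_
  let F : ℝ → X → X := fun s x => NormedSpace.exp (-s • A) (B (NormedSpace.exp (s • A) x))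
  let c : ℝ≥0 := ⟨Real.exp (T * ‖A‖), (Real.exp_pos _).le⟩
  let t₀ : Set.Icc (-T) T := ⟨0, by constructor <;> linarith⟩
  -- The interaction-picture field is bounded on all of `X` for `|s| ≤ T`. A ball whose radius is
  -- this bound times `T` contains the orbit, so the whole interval is handled at once.
  have hPL : IsPicardLindelof F t₀ x₀ (c * ⟨κ, hκ0⟩ * ⟨T, hT.le⟩) 0 (c * ⟨κ, hκ0⟩)
      (c * (K * c)) := by
    refine ⟨fun t ht => ?_, fun x _ => ?_, fun t ht x _ => ?_, ?_⟩
    · refine (LipschitzWith.of_dist_le_mul fun x y => ?_).lipschitzOnWith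
      rw [dist_eq_norm, dist_eq_norm]
      exact norm_interaction_sub_le A hK (abs_le.2 ht) x y
    · exact ((continuous_interaction A hB.continuous).comp
        (continuous_id.prodMk continuous_const)).continuousOn
    · exact norm_interaction_le A hκ (abs_le.2 ht) x
    · simp only [t₀, sub_zero, zero_sub, neg_neg, max_self, NNReal.coe_zero]
      exact le_rfl
  obtain ⟨α, hα0, hα⟩ := hPL.exists_eq_forall_mem_Icc_hasDerivWithinAt₀
  refine ⟨fun t => NormedSpace.exp (t • A) (α t), by simpa using hα0, fun t ht => ?_⟩
  have h1 := hasDerivAt_exp_smul_apply A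
    ((hα t ⟨ht.1.le, ht.2.le⟩).hasDerivAt (Icc_mem_nhds ht.1 ht.2))
  simpa only [F, exp_smul_apply_exp_neg_smul] using h1

end Dynamics

/-! ### Gradients of potentials -/

section Gradients

variable {W X : Type*} [NormedAddCommGroup W] [InnerProductSpace ℝ W]
  [NormedAddCommGroup X] [InnerProductSpace ℝ X]

/-- A Landau-type inequality: a step of length `h` along the gradient changes `V` by `h * ‖gradient
V x‖` up to an error `K * h ^ 2`. -/
theorem exists_mul_norm_gradient_le [CompleteSpace W] {V : W → ℝ} {K : ℝ≥0}
    (hV : Differentiable ℝ V) (hK : LipschitzWith K (gradient V)) (x : W) {h : ℝ} (hh : 0 < h) :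
    ∃ y, ‖y - x‖ ≤ h ∧ h * ‖gradient V x‖ ≤ |V y| + |V x| + K * h ^ 2 := by
  set g := gradient V x with hg
  rcases eq_or_ne g 0 with h0 | h0
  · refine ⟨x, by simpa using hh.le, ?_⟩
    rw [h0, norm_zero, mul_zero]
    positivity
  have hgn : 0 < ‖g‖ := norm_pos_iff.2 h0
  have hyx : x + (h / ‖g‖) • g - x = (h / ‖g‖) • g := add_sub_cancel_left _ _
  have hnorm : ‖x + (h / ‖g‖) • g - x‖ = h := by
    rw [hyx, norm_smul, Real.norm_eq_abs, abs_of_pos (by positivity)]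
    field_simp
  refine ⟨x + (h / ‖g‖) • g, hnorm.le, ?_⟩
  have hmv := (convex_closedBall x h).norm_image_sub_le_of_norm_hasFDerivWithin_le'
    (f := V) (f' := fun z => InnerProductSpace.toDual ℝ W (gradient V z))
    (φ := InnerProductSpace.toDual ℝ W g) (C := K * h)
    (fun z _ => ((hV z).hasGradientAt.hasFDerivAt).hasFDerivWithinAt)
    (fun z hz => by
      rw [← map_sub, LinearIsometryEquiv.norm_map, hg]
      refine (hK.norm_sub_le _ _).trans ?_
      gcongr
      exact mem_closedBall_iff_norm.1 hz)
    (Metric.mem_closedBall_self hh.le) (mem_closedBall_iff_norm.2 hnorm.le)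
  rw [hnorm, InnerProductSpace.toDual_apply_apply, hyx, inner_smul_right,
    real_inner_self_eq_norm_sq, Real.norm_eq_abs] at hmv
  have h1 : h / ‖g‖ * ‖g‖ ^ 2 = h * ‖g‖ := by field_simp
  rw [h1] at hmv
  have h2 := (abs_le.1 hmv).1
  have h3 := le_abs_self (V (x + (h / ‖g‖) • g))
  have h4 := neg_abs_le (V x)
  nlinarith

/-- If a function vanishes at infinity and its gradient is Lipschitz continuous, then its gradient
vanishes at infinity. -/
theorem tendsto_gradient_cobounded [CompleteSpace W] {V : W → ℝ} {K : ℝ≥0}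
    (hV : Differentiable ℝ V) (hK : LipschitzWith K (gradient V))
    (h0 : Tendsto V (Bornology.cobounded W) (𝓝 0)) :
    Tendsto (gradient V) (Bornology.cobounded W) (𝓝 0) := by
  rw [Metric.tendsto_nhds]
  intro ε hε
  -- The error `K * h ^ 2` takes at most `h * ε / 2` and the two values of `V` less than `h * ε /
  -- 4`. The radius `R + h` below keeps `y` in the region where `V` is small.
  set h : ℝ := ε / (2 * (K + 1)) with hh
  have hpos : 0 < h := by positivity
  have hKh : K * h ≤ ε / 2 := by
    have h1 : (K + 1) * h = ε / 2 := by rw [hh]; field_simp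
    nlinarith
  have hsmall := Metric.tendsto_nhds.1 h0 (h * ε / 8) (by positivity)
  obtain ⟨R, -, hR⟩ := (hasBasis_cobounded_norm (E := W)).eventually_iff.1 hsmall
  refine (hasBasis_cobounded_norm (E := W)).eventually_iff.2 ⟨R + h, trivial, fun x hx => ?_⟩
  obtain ⟨y, hy, hyx⟩ := exists_mul_norm_gradient_le hV hK x hpos
  have hx' : R + h ≤ ‖x‖ := hx
  have h1 : |V x| < h * ε / 8 := by
    have : x ∈ {z : W | R ≤ ‖z‖} := by
      change R ≤ ‖x‖
      linarith
    simpa [dist_eq_norm] using hR this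
  have h2 : |V y| < h * ε / 8 := by
    have : y ∈ {z : W | R ≤ ‖z‖} := by
      have := norm_sub_norm_le x y
      rw [norm_sub_rev] at this
      change R ≤ ‖y‖
      linarith
    simpa [dist_eq_norm] using hR this
  rw [dist_zero_right]
  refine lt_of_mul_lt_mul_left ?_ hpos.le
  nlinarith

omit [InnerProductSpace ℝ W] in
theorem exists_norm_le_of_tendsto_zero [ProperSpace W] {G : W → W} (hG : Continuous G)
    (h0 : Tendsto G (Bornology.cobounded W) (𝓝 0)) : ∃ κ, ∀ w, ‖G w‖ ≤ κ := by
  rw [Metric.cobounded_eq_cocompact] at h0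
  let f : ZeroAtInftyContinuousMap W W := ⟨⟨G, hG⟩, h0⟩
  exact ⟨‖f.toBCF‖, fun w => f.toBCF.norm_coe_le_norm w⟩

theorem hasGradientAt_comp_clm [CompleteSpace W] [CompleteSpace X] {f : W → ℝ} {g : W}
    (Q : X →L[ℝ] W) {x : X} (hf : HasGradientAt f g (Q x)) :
    HasGradientAt (fun y => f (Q y)) (Q.adjoint g) x := by
  rw [hasGradientAt_iff_hasFDerivAt] at hf ⊢
  refine (hf.comp x Q.hasFDerivAt).congr_fderiv ?_
  ext y
  simp [ContinuousLinearMap.adjoint_inner_left]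

theorem hasGradientAt_const_mul_norm_sq [CompleteSpace W] (c : ℝ) (w : W) :
    HasGradientAt (fun y => c * ‖y‖ ^ 2) ((2 * c) • w) w := by
  rw [hasGradientAt_iff_hasFDerivAt]
  refine ((hasStrictFDerivAt_norm_sq w).hasFDerivAt.const_mul c).congr_fderiv ?_
  ext y
  simp
  ring

theorem HasGradientAt.finset_sum [CompleteSpace W] {ι : Type*} (s : Finset ι) {f : ι → W → ℝ}
    {g : ι → W} {x : W} (hf : ∀ i ∈ s, HasGradientAt (f i) (g i) x) :
    HasGradientAt (fun y => ∑ i ∈ s, f i y) (∑ i ∈ s, g i) x := by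
  rw [hasGradientAt_iff_hasFDerivAt, map_sum]
  exact HasFDerivAt.fun_sum fun i hi => (hf i hi).hasFDerivAt

end Gradients

/-! ### The lattice Hamiltonian as an admissible perturbation -/

section Lattice

variable {Λ : Type*} [Fintype Λ] {n : ℕ}

/-- `x ↦ x_l` as a continuous linear map. -/
def particleCLM (l : Λ) : Config Λ n →L[ℝ] EuclideanSpace ℝ (Fin n) :=
  LinearMap.toContinuousLinearMap
    { toFun := fun x => particle x l
      map_add' := fun _ _ => rfl
      map_smul' := fun _ _ => rfl }

/-- `(p, q) ↦ p` as a continuous linear map. -/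
def momCLM : Phase Λ n →L[ℝ] Config Λ n :=
  LinearMap.toContinuousLinearMap
    { toFun := mom
      map_add' := fun _ _ => rfl
      map_smul' := fun _ _ => rfl }

/-- `(p, q) ↦ q` as a continuous linear map. -/
def posCLM : Phase Λ n →L[ℝ] Config Λ n :=
  LinearMap.toContinuousLinearMap
    { toFun := pos
      map_add' := fun _ _ => rfl
      map_smul' := fun _ _ => rfl }

/-- `p ↦ (p, 0)` as a continuous linear map. -/
def momInclusion : Config Λ n →L[ℝ] Phase Λ n :=
  LinearMap.toContinuousLinearMap
    { toFun := fun p => phasePoint p 0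
      map_add' := fun p p' => by ext (j | j) <;> simp [phasePoint]
      map_smul' := fun c p => by ext (j | j) <;> simp [phasePoint] }

/-- `q ↦ (0, q)` as a continuous linear map. -/
def posInclusion : Config Λ n →L[ℝ] Phase Λ n :=
  LinearMap.toContinuousLinearMap
    { toFun := fun q => phasePoint 0 q
      map_add' := fun p p' => by ext (j | j) <;> simp [phasePoint]
      map_smul' := fun c p => by ext (j | j) <;> simp [phasePoint] }

theorem particleCLM_apply (l : Λ) (x : Config Λ n) : particleCLM l x = particle x l := rfl

theorem phasePoint_eq (p q : Config Λ n) :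
    phasePoint p q = momInclusion p + posInclusion q := by
  change _ = phasePoint p 0 + phasePoint 0 q
  ext (j | j) <;> simp [phasePoint]

/-- The diagonal operator multiplying `x_l` by `c_l`. -/
def particleScaling (c : Λ → ℝ) : Config Λ n →L[ℝ] Config Λ n :=
  ∑ l, c l • (particleCLM l).adjoint.comp (particleCLM l)

/-- The constants `a l` absorb the kinetic or the oscillator energy, whichever is held fixed, so
both partial gradients are covered. -/
theorem hasGradientAt_sum_particle (c a : Λ → ℝ) (x : Config Λ n) :
    HasGradientAt (fun y => ∑ l, (a l + c l * ‖particle y l‖ ^ 2 / 2)) (particleScaling c x) x := by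
  have h : particleScaling c x =
      ∑ l, (particleCLM l).adjoint ((2 * (c l / 2)) • particleCLM l x) := by
    simp [particleScaling, mul_div_cancel₀]
  rw [h]
  refine HasGradientAt.finset_sum _ fun l _ => ?_
  have h1 := hasGradientAt_comp_clm (particleCLM l) (x := x)
    (hasGradientAt_const_mul_norm_sq (c l / 2) (particleCLM l x))
  have h2 : (fun y : Config Λ n => a l + c l * ‖particle y l‖ ^ 2 / 2) =
      fun y => a l + c l / 2 * ‖particleCLM l y‖ ^ 2 := by
    funext y
    rw [particleCLM_apply]
    ring
  rw [h2]
  exact h1.hasFDerivAt.const_add (a l)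

/-- The map `q ↦ q_k - q_l` for a chosen ordering of the pair `e = {k, l}`. -/
def pairDifference (e : Sym2 Λ) : Config Λ n →L[ℝ] EuclideanSpace ℝ (Fin n) :=
  particleCLM (Quot.out e).1 - particleCLM (Quot.out e).2

theorem pairPotential_eq (V : Λ → Λ → EuclideanSpace ℝ (Fin n) → ℝ)
    (hV : ∀ k l x, V k l x = V l k (-x)) (N : Finset (Sym2 Λ)) (q : Config Λ n) :
    pairPotential V hV N q =
      ∑ e ∈ N, V (Quot.out e).1 (Quot.out e).2 (pairDifference e q) := by
  refine Finset.sum_congr rfl fun e _ => ?_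
  have he : s((Quot.out e).1, (Quot.out e).2) = e := Quot.out_eq e
  -- On an explicit pair `Sym2.lift` computes definitionally.
  conv_lhs => rw [← he]
  rfl

/-- The linear vector field of the free Hamiltonian. -/
def freeField (m ν : Λ → ℝ) : Phase Λ n →L[ℝ] Phase Λ n :=
  -(momInclusion.comp ((particleScaling ν).comp posCLM)) +
    posInclusion.comp ((particleScaling fun l => (m l)⁻¹).comp momCLM)

/-- The vector field of the interaction. -/
def interactionField (V : Λ → Λ → EuclideanSpace ℝ (Fin n) → ℝ) (N : Finset (Sym2 Λ))
    (ω : Phase Λ n) : Phase Λ n :=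
  ∑ e ∈ N, (-(momInclusion.comp (pairDifference e).adjoint))
    (gradient (V (Quot.out e).1 (Quot.out e).2) ((pairDifference e).comp posCLM ω))

theorem hamiltonianField_eq (m ν : Λ → ℝ) (V : Λ → Λ → EuclideanSpace ℝ (Fin n) → ℝ)
    (hV : ∀ k l x, V k l x = V l k (-x)) (N : Finset (Sym2 Λ))
    (hd : ∀ k l, s(k, l) ∈ N → Differentiable ℝ (V k l)) (ω : Phase Λ n) :
    hamiltonianField (hamiltonian m ν V hV N) ω = freeField m ν ω + interactionField V N ω := by
  have hp : HasGradientAt (fun p => hamiltonian m ν V hV N p (pos ω))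
      (particleScaling (fun l => (m l)⁻¹) (mom ω)) (mom ω) := by
    have h1 := hasGradientAt_sum_particle (fun l => (m l)⁻¹)
      (fun l => ν l * ‖particle (pos ω) l‖ ^ 2 / 2) (mom ω)
    have h2 : (fun p => hamiltonian m ν V hV N p (pos ω)) = fun p => (∑ l,
        (ν l * ‖particle (pos ω) l‖ ^ 2 / 2 + (m l)⁻¹ * ‖particle p l‖ ^ 2 / 2)) +
        pairPotential V hV N (pos ω) := by
      funext p
      rw [hamiltonian, freeHamiltonian]
      congr 1
      refine Finset.sum_congr rfl fun l _ => ?_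
      ring
    rw [h2]
    exact h1.hasFDerivAt.add_const _
  have hq : HasGradientAt (fun q => hamiltonian m ν V hV N (mom ω) q)
      (particleScaling ν (pos ω) + ∑ e ∈ N, (pairDifference e).adjoint
        (gradient (V (Quot.out e).1 (Quot.out e).2) (pairDifference e (pos ω)))) (pos ω) := by
    have h1 := hasGradientAt_sum_particle ν
      (fun l => ‖particle (mom ω) l‖ ^ 2 / (2 * m l)) (pos ω)
    have h2 := HasGradientAt.finset_sum N fun e he => hasGradientAt_comp_clm (pairDifference e)
      (x := pos ω) (hd (Quot.out e).1 (Quot.out e).2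
        (by rwa [show s((Quot.out e).1, (Quot.out e).2) = e from Quot.out_eq e]) _).hasGradientAt
    simp only [hamiltonian, freeHamiltonian, pairPotential_eq]
    rw [hasGradientAt_iff_hasFDerivAt, map_add]
    exact h1.hasFDerivAt.add h2.hasFDerivAt
  rw [hamiltonianField, hp.gradient, hq.gradient, phasePoint_eq]
  simp only [freeField, interactionField, map_neg, map_add, map_sum, neg_apply,
    add_apply, ContinuousLinearMap.comp_apply, Finset.sum_neg_distrib, neg_add]
  change _ = -momInclusion (particleScaling ν (pos ω)) + _ + _
  exact add_right_comm _ _ _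

theorem admissiblePerturbation_interactionField (V : Λ → Λ → EuclideanSpace ℝ (Fin n) → ℝ)
    (N : Finset (Sym2 Λ)) (hd : ∀ k l, s(k, l) ∈ N → Differentiable ℝ (V k l))
    (hC0 : ∀ k l, s(k, l) ∈ N →
      Tendsto (V k l) (cocompact (EuclideanSpace ℝ (Fin n))) (𝓝 0))
    (hLip : ∀ k l, s(k, l) ∈ N → ∃ K : ℝ≥0, LipschitzWith K (gradient (V k l))) :
    AdmissiblePerturbation (interactionField V N) := by
  refine AdmissiblePerturbation.sum N fun e he => ?_
  have he' : s((Quot.out e).1, (Quot.out e).2) ∈ N := by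
    rwa [show s((Quot.out e).1, (Quot.out e).2) = e from Quot.out_eq e]
  obtain ⟨K, hK⟩ := hLip _ _ he'
  have h0 := tendsto_gradient_cobounded (hd _ _ he') hK
    (by rw [Metric.cobounded_eq_cocompact]; exact hC0 _ _ he')
  obtain ⟨κ, hκ⟩ := exists_norm_le_of_tendsto_zero hK.continuous h0
  exact AdmissiblePerturbation.of_tendsto_zero hK hκ h0 _ _

end Lattice

end

end ResolventLattice

theorem mainTheorem2 {Λ : Type*} [Fintype Λ] (n : ℕ)
    (m ν : Λ → ℝ) (hm : ∀ l, 0 < m l) (hν : ∀ l, 0 < ν l)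
    (V : Λ → Λ → EuclideanSpace ℝ (Fin n) → ℝ)
    (hV : ∀ k l x, V k l x = V l k (-x))
    (N : Finset (Sym2 Λ)) (hN : ∀ e ∈ N, ¬ e.IsDiag)
    (hC1 : ∀ k l, s(k, l) ∈ N → ContDiff ℝ 1 (V k l))
    (hC0 : ∀ k l, s(k, l) ∈ N →
      Filter.Tendsto (V k l) (Filter.cocompact (EuclideanSpace ℝ (Fin n))) (nhds 0))
    (hLip : ∀ k l, s(k, l) ∈ N → ∃ K : NNReal, LipschitzWith K (gradient (V k l))) :
    (∀ ω₀ : ResolventLattice.Phase Λ n, ∃! γ : ℝ → ResolventLattice.Phase Λ n,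
      ResolventLattice.IsSolution (ResolventLattice.hamiltonian m ν V hV N) ω₀ γ) ∧
    ∀ Φ : ℝ → ResolventLattice.Phase Λ n → ResolventLattice.Phase Λ n,
      ResolventLattice.IsHamiltonianFlow (ResolventLattice.hamiltonian m ν V hV N) Φ →
      ∀ t : ℝ,
        (fun f : ResolventLattice.Phase Λ n → ℂ => f ∘ Φ t) ''
            ResolventLattice.resolventFunctions (ResolventLattice.Phase Λ n) =
          ResolventLattice.resolventFunctions (ResolventLattice.Phase Λ n) := by
  have hd : ∀ k l, s(k, l) ∈ N → Differentiable ℝ (V k l) := fun k l h =>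
    (hC1 k l h).differentiable one_ne_zero
  have hB := ResolventLattice.admissiblePerturbation_interactionField V N hd hC0 hLip
  have hfield := ResolventLattice.hamiltonianField_eq m ν V hV N hd
  simp only [ResolventLattice.IsHamiltonianFlow, ResolventLattice.IsSolution, hfield]
  refine ⟨fun ω₀ => ?_, fun Φ hΦ t => ?_⟩
  · obtain ⟨γ, hγ0, hγ⟩ := hB.exists_solution (ResolventLattice.freeField m ν) ω₀
    obtain ⟨K, hK⟩ := hB.lipschitz_field (ResolventLattice.freeField m ν)
    exact ⟨γ, ⟨hγ0, hγ⟩, fun γ' hγ' => ResolventLattice.eq_of_global_solutions hK hγ'.2 hγ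
      (hγ'.1.trans hγ0.symm)⟩
  · exact hB.image_comp_flow (ResolventLattice.freeField m ν) (fun x => (hΦ x).1)
      (fun x => (hΦ x).2) t
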